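/- All graphs are finite. Two directed acyclic graphs (DAGs) on the same vertex set are Markov equivalent if they encode the same conditional independencies, that is, if they have the same d-separations. The essential graph of a DAG $D$ has the same skeleton as $D$, and an edge is directed in it if and only if the edge has the same orientation in every DAG Markov equivalent to $D$. For an undirected chordal graph $K$ (every cycle with four or more vertices has a chord; $K$ need not be connected), let $\mathrm{Size}(K)$ be the size of the Markov equivalence class represented by $K$, that is, the number of DAGs whose essential graph is $K$ (all edges undirected). For an integer $m\ge 0$ let $K^{m+}$ be the graph obtained from $K$ by adding $m$ dominating vertices, that is, $m$ new vertices adjacent to each other and to all vertices of $K$, and let $f(K,m)=\mathrm{Size}(K^{m+})$. Let $K_1$ be an undirected chordal graph, let $j\ge 0$, and let $K$ be a graph composed of $K_1$ and $j$ isolated vertices (the disjoint union of $K_1$ and $j$ isolated vertices). Then for every integer $m\ge 0$ $$f(K,m)=f(K_1,m)+j\cdot \mathrm{Size}(K_1)\cdot m\,m!.$$ In particular, if $K_1$ is the null graph (the graph without vertices), then $f(K,m)=(jm+1)\,m!$. -/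

import Mathlib

namespace MarkovSize

/-- A directed acyclic graph on the vertex set `V`: no directed walk of positive length returns to
its starting vertex (in particular there are no loops and no pairs of opposite arrows). -/
@[ext]
structure DAG (V : Type*) extends Digraph V where
  acyclic : ∀ v, ¬ Relation.TransGen Adj v v

namespace DAG

variable {V : Type*}

/-- The skeleton of a DAG: the undirected graph obtained by forgetting the directions. -/
def skeleton (D : DAG V) : SimpleGraph V := D.toDigraph.toSimpleGraphInclusive

/-- `a → b ← c` -/
def IsCollider (D : DAG V) (a b c : V) : Prop := D.Adj a b ∧ D.Adj c b

/-- A path `p` (a path of the skeleton) is active given `S` if each inner vertex that is a collider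
on the path is in `S` or has a descendant in `S`, and no other inner vertex is in `S`. -/
def IsActive (D : DAG V) (S : Set V) {x y : V} (p : D.skeleton.Walk x y) : Prop :=
  p.IsPath ∧ ∀ i : ℕ, i + 1 < p.length →
    (D.IsCollider (p.getVert i) (p.getVert (i + 1)) (p.getVert (i + 2)) →
      ∃ s ∈ S, Relation.ReflTransGen D.Adj (p.getVert (i + 1)) s) ∧
    (¬ D.IsCollider (p.getVert i) (p.getVert (i + 1)) (p.getVert (i + 2)) →
      p.getVert (i + 1) ∉ S)

/-- `A` and `B` are d-separated by `S` in `D`: there is no active path from `A` to `B` given `S`.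
For pairwise disjoint `A`, `B`, `S` this says that `D` encodes the conditional
independence of `A` and `B` given `S`. -/
def DSep (D : DAG V) (A B S : Set V) : Prop :=
  ∀ x ∈ A, ∀ y ∈ B, ∀ p : D.skeleton.Walk x y, ¬ D.IsActive S p

/-- Two DAGs are Markov equivalent if they encode the same conditional independencies. -/
def MarkovEquivalent (D D' : DAG V) : Prop :=
  ∀ A B S : Set V, Disjoint A B → Disjoint A S → Disjoint B S →
    (D.DSep A B S ↔ D'.DSep A B S)

/-- The essential graph of (the Markov equivalence class of) `D`. A graph with directed and
undirected edges is coded as a digraph in which the undirected edge `u - v` is the pair of arrows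
`u → v` and `v → u`. The essential graph has the skeleton of `D`, and an edge is directed as
`u → v` (the arrow `v → u` is missing) exactly if every DAG equivalent to `D` has `u → v`. -/
def essentialGraph (D : DAG V) : Digraph V where
  Adj u v := D.skeleton.Adj u v ∧ ¬ ∀ D' : DAG V, MarkovEquivalent D D' → D'.Adj v u

end DAG

variable {V : Type*}

/-- The size of the Markov equivalence class represented by an essential graph `C`: the number of
DAGs whose Markov equivalence class has the essential graph `C`. -/
noncomputable def essSize (C : Digraph V) : ℕ := Nat.card {D : DAG V // D.essentialGraph = C}

/-- An undirected graph, as a graph all of whose edges are undirected. -/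
def undirected (K : SimpleGraph V) : Digraph V where
  Adj := K.Adj

/-- `Size(K)` for an undirected graph `K`. -/
noncomputable def Size (K : SimpleGraph V) : ℕ := essSize (undirected K)

/-- Every cycle with four or more vertices has a chord. -/
def IsChordal (K : SimpleGraph V) : Prop :=
  ∀ (v : V) (c : K.Walk v v), c.IsCycle → 4 ≤ c.length →
    ∃ x ∈ c.support, ∃ y ∈ c.support, K.Adj x y ∧ s(x, y) ∉ c.edges

/-- The extended graph of `K`: add `m` dominating vertices to `K`. -/
def extend (K : SimpleGraph V) (m : ℕ) : SimpleGraph (V ⊕ Fin m) where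
  Adj
    | .inl u, .inl v => K.Adj u v
    | a, b => a ≠ b
  symm := ⟨by
    rintro (u | i) (v | j) h
    · exact K.adj_symm h
    all_goals exact Ne.symm h⟩
  loopless := ⟨by
    rintro (u | i) h
    · exact K.loopless.irrefl u h
    · exact h rfl⟩

/-- `f(K, m)`: the size of the extended graph of `K` with `m` additional dominating vertices. -/
noncomputable def f (K : SimpleGraph V) (m : ℕ) : ℕ := Size (extend K m)

/-- `K` is composed of `K₁` and `j` isolated vertices: `K` is, up to the names of the vertices, the
disjoint union of `K₁` and the graph with `j` vertices and no edges. -/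
def IsComposedOf {V₁ : Type*} (K : SimpleGraph V) (K₁ : SimpleGraph V₁) (j : ℕ) : Prop :=
  Nonempty (K ≃g K₁.sum (⊥ : SimpleGraph (Fin j)))

end MarkovSize

namespace MarkovSize

/-- A relation is a *moral orientation* of `K` if it orients each edge of `K` in exactly one
direction, admits a topological ranking, and any two parents of a common child are adjacent. -/
structure Moral {V : Type*} (K : SimpleGraph V) (r : V → V → Prop) : Prop where
  adj_iff : ∀ a b, K.Adj a b ↔ r a b ∨ r b a
  rank : ∃ ρ : V → ℕ, ∀ a b, r a b → ρ a < ρ b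
  parents : ∀ a b c, r a c → r b c → a ≠ b → K.Adj a b

theorem Moral.asymm {V : Type*} {K : SimpleGraph V} {r : V → V → Prop} (h : Moral K r) {a b : V}
    (hab : r a b) : ¬ r b a := by
  obtain ⟨ρ, hρ⟩ := h.rank
  intro hba
  exact absurd (hρ _ _ hab) (hρ _ _ hba).asymm

theorem rank_transGen {V : Type*} {r : V → V → Prop} {ρ : V → ℕ}
    (h : ∀ a b, r a b → ρ a < ρ b) {a b : V} (hab : Relation.TransGen r a b) : ρ a < ρ b := by
  induction hab with
  | single h1 => exact h _ _ h1
  | tail _ h1 ih => exact ih.trans (h _ _ h1)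

theorem exists_rank {V : Type*} [Finite V] {r : V → V → Prop}
    (h : ∀ v, ¬ Relation.TransGen r v v) : ∃ ρ : V → ℕ, ∀ a b, r a b → ρ a < ρ b := by
  refine ⟨fun v => {a | Relation.TransGen r a v}.ncard, fun a b hab => ?_⟩
  apply Set.ncard_lt_ncard _ (Set.toFinite _)
  refine ⟨fun x hx => hx.tail hab, fun hs => h a (hs (Relation.TransGen.single hab))⟩

namespace DAG

variable {V : Type*}

theorem skeleton_adj {D : DAG V} {a b : V} : D.skeleton.Adj a b ↔ D.Adj a b ∨ D.Adj b a := by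
  constructor
  · exact fun h => h.2
  · intro h
    refine ⟨?_, h⟩
    rintro rfl
    exact D.acyclic a (.single (or_self_iff.1 h))

theorem asymm (D : DAG V) {a b : V} (hab : D.Adj a b) : ¬ D.Adj b a :=
  fun hba => D.acyclic a (.head hab (.single hba))

/-- The parents of `u` separate `u` from every nonadjacent nondescendant. -/
theorem not_isActive_parents (D : DAG V) {u v : V} (hadj : ¬ D.skeleton.Adj u v)
    (hdesc : ¬ Relation.ReflTransGen D.Adj u v) (p : D.skeleton.Walk u v) :
    ¬ D.IsActive {w | D.Adj w u} p := by
  rintro ⟨-, hact⟩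
  have hlen : 2 ≤ p.length := by
    by_contra! hlt
    interval_cases hl : p.length
    · exact hdesc (SimpleGraph.Walk.eq_of_length_eq_zero hl ▸ .refl)
    · exact hadj (SimpleGraph.Walk.adj_of_length_eq_one hl)
  have hstep : ∀ i, i < p.length → D.skeleton.Adj (p.getVert i) (p.getVert (i + 1)) :=
    fun i hi => p.adj_getVert_succ hi
  have hfirst : D.Adj (p.getVert 0) (p.getVert 1) := by
    rcases skeleton_adj.1 (hstep 0 (by omega)) with h | h
    · exact h
    · exfalso
      refine (hact 0 (by omega)).2 (fun hc => D.asymm h hc.1) ?_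
      simpa using h
  have key : ∀ i, i < p.length → Relation.ReflTransGen D.Adj u (p.getVert i) ∧
      D.Adj (p.getVert i) (p.getVert (i + 1)) := by
    intro i
    induction i with
    | zero => exact fun _ => ⟨by simpa using Relation.ReflTransGen.refl, hfirst⟩
    | succ i ih =>
      intro hi
      obtain ⟨h1, h2⟩ := ih (by omega)
      refine ⟨h1.tail h2, ?_⟩
      rcases skeleton_adj.1 (hstep (i + 1) hi) with h | h
      · exact h
      · exfalso
        obtain ⟨s, hs, hreach⟩ := (hact i hi).1 ⟨h2, h⟩
        exact D.acyclic u (.tail' ((h1.tail h2).trans hreach) hs)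
  obtain ⟨h1, h2⟩ := key (p.length - 1) (by omega)
  have h3 := h1.tail h2
  rw [show p.length - 1 + 1 = p.length by omega, p.getVert_length] at h3
  exact hdesc h3

theorem dSep_parents (D : DAG V) {u v : V} (hadj : ¬ D.skeleton.Adj u v)
    (hdesc : ¬ Relation.ReflTransGen D.Adj u v) : D.DSep {u} {v} {w | D.Adj w u} := by
  rintro x rfl y rfl p
  exact D.not_isActive_parents hadj hdesc p

theorem not_reach_or_not_reach (D : DAG V) {u v : V} (h : u ≠ v) :
    ¬ Relation.ReflTransGen D.Adj u v ∨ ¬ Relation.ReflTransGen D.Adj v u := by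
  by_contra! hc
  rcases Relation.reflTransGen_iff_eq_or_transGen.1 hc.1 with h1 | h1
  · exact h h1.symm
  · exact D.acyclic u (h1.trans_left hc.2)

theorem not_dSep_of_adj (D : DAG V) {u v : V} (h : D.skeleton.Adj u v) (S : Set V) :
    ¬ D.DSep {u} {v} S := by
  intro hs
  refine hs u rfl v rfl h.toWalk ⟨by simp [SimpleGraph.Walk.isPath_def, h.ne], ?_⟩
  intro i hi
  simp at hi

theorem MarkovEquivalent.symm {D D' : DAG V} (h : MarkovEquivalent D D') :
    MarkovEquivalent D' D := fun A B S h1 h2 h3 => (h A B S h1 h2 h3).symm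

theorem MarkovEquivalent.dSep_parents {D D' : DAG V} (h : MarkovEquivalent D D') {u v : V}
    (huv : u ≠ v) (hadj : ¬ D.skeleton.Adj u v) (hdesc : ¬ Relation.ReflTransGen D.Adj u v) :
    D'.DSep {u} {v} {w | D.Adj w u} := by
  refine (h _ _ _ ?_ ?_ ?_).1 (D.dSep_parents hadj hdesc)
  · simpa using huv
  · simpa using fun hu => D.asymm hu hu
  · simpa using fun hu => hadj (skeleton_adj.2 (.inr hu))

theorem MarkovEquivalent.adj {D D' : DAG V} (h : MarkovEquivalent D D') {u v : V}
    (hadj : D.skeleton.Adj u v) : D'.skeleton.Adj u v := by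
  by_contra hn
  rcases D'.not_reach_or_not_reach hadj.ne with hr | hr
  · exact D.not_dSep_of_adj hadj _ (h.symm.dSep_parents hadj.ne hn hr)
  · exact D.not_dSep_of_adj hadj.symm _
      (h.symm.dSep_parents hadj.ne' (fun h' => hn h'.symm) hr)

theorem isCollider_of_dSep (D : DAG V) {a b c : V} (hac : a ≠ c) (hab : D.skeleton.Adj a b)
    (hbc : D.skeleton.Adj b c) {S : Set V} (hb : b ∉ S) (hs : D.DSep {a} {c} S) :
    D.IsCollider a b c := by
  by_contra hn
  refine hs a rfl c rfl (.cons hab (.cons hbc .nil))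
    ⟨by simp [SimpleGraph.Walk.isPath_def, hab.ne, hbc.ne, hac], ?_⟩
  intro i hi
  have : i = 0 := by simp at hi; omega
  subst this
  exact ⟨fun h => absurd h hn, fun _ => hb⟩

/-- Unshielded colliders persist under Markov equivalence. -/
theorem MarkovEquivalent.isCollider {D D' : DAG V} (h : MarkovEquivalent D D') {a b c : V}
    (hac : a ≠ c) (hn : ¬ D.skeleton.Adj a c) (hc : D.IsCollider a b c) :
    D'.IsCollider a b c := by
  have hab : D'.skeleton.Adj a b := h.adj (skeleton_adj.2 (.inl hc.1))
  have hcb : D'.skeleton.Adj c b := h.adj (skeleton_adj.2 (.inl hc.2))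
  rcases D.not_reach_or_not_reach hac with hr | hr
  · exact D'.isCollider_of_dSep hac hab hcb.symm (fun hb => D.asymm hc.1 hb)
      (h.dSep_parents hac hn hr)
  · exact (D'.isCollider_of_dSep hac.symm hcb hab.symm (fun hb => D.asymm hc.2 hb)
      (h.dSep_parents hac.symm (fun h' => hn h'.symm) hr)).symm

end DAG

/-- The edges of `K` that avoid `S`. -/
def avoiding {V : Type*} (K : SimpleGraph V) (S : Set V) : SimpleGraph V where
  Adj a b := K.Adj a b ∧ a ∉ S ∧ b ∉ S
  symm := ⟨fun _ _ h => ⟨h.1.symm, h.2.2, h.2.1⟩⟩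
  loopless := ⟨fun _ h => h.1.ne rfl⟩

theorem dist_le_of_shortcut {V : Type*} {G : SimpleGraph V} {x y : V} (p : G.Walk x y) {i : ℕ}
    (hi : i + 1 < p.length) (h : G.Adj (p.getVert i) (p.getVert (i + 2))) :
    G.dist x y < p.length := by
  have := SimpleGraph.dist_le ((p.take i).append (.cons h (p.drop (i + 2))))
  simp only [SimpleGraph.Walk.length_append, SimpleGraph.Walk.length_cons,
    SimpleGraph.Walk.take_length, SimpleGraph.Walk.drop_length] at this
  omega

namespace DAG

variable {V : Type*}

/-- In a DAG without unshielded colliders, d-separation is separation in the skeleton. -/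
theorem dSep_iff_of_moral (D : DAG V) (hD : Moral D.skeleton D.Adj) {A B S : Set V}
    (hAS : Disjoint A S) (hBS : Disjoint B S) :
    D.DSep A B S ↔ ∀ x ∈ A, ∀ y ∈ B, ¬ (avoiding D.skeleton S).Reachable x y := by
  have hle : avoiding D.skeleton S ≤ D.skeleton := fun _ _ h => h.1
  constructor
  · intro hs x hx y hy hr
    obtain ⟨p, hp, hlen⟩ := hr.exists_path_of_dist
    refine hs x hx y hy (p.mapLe hle) ⟨(SimpleGraph.Walk.isPath_mapLe hle).2 hp, ?_⟩
    intro i hi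
    have hi' : i + 1 < p.length := by simpa using hi
    have h1 := p.adj_getVert_succ (show i < p.length by omega)
    have h2 := p.adj_getVert_succ hi'
    have hg : ∀ k, (p.mapLe hle).getVert k = p.getVert k := fun k => by
      simp [SimpleGraph.Walk.mapLe]
    simp only [hg]
    refine ⟨fun hc => ?_, fun _ => h2.2.1⟩
    exfalso
    have hne : p.getVert i ≠ p.getVert (i + 2) := fun he => by
      have := hp.getVert_injOn (by simp; omega) (by simp; omega) he
      omega
    have := dist_le_of_shortcut p hi' ⟨hD.parents _ _ _ hc.1 hc.2 hne, h1.2.1, h2.2.2⟩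
    omega
  · rintro hr x hx y hy p ⟨-, hact⟩
    refine hr x hx y hy ?_
    have hxS : x ∉ S := hAS.notMem_of_mem_left hx
    have hyS : y ∉ S := hBS.notMem_of_mem_left hy
    -- a vertex of `S` on the path is a collider, and its neighbours on the path avoid `S`
    have hcol : ∀ i, i + 1 < p.length → p.getVert (i + 1) ∈ S →
        D.IsCollider (p.getVert i) (p.getVert (i + 1)) (p.getVert (i + 2)) :=
      fun i hi hS => by_contra fun hn => (hact i hi).2 hn hS
    have key : ∀ n, ∀ i ≤ n, i ≤ p.length → p.getVert i ∉ S →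
        (avoiding D.skeleton S).Reachable x (p.getVert i) := by
      intro n
      induction n with
      | zero =>
        intro i hi _ _
        obtain rfl : i = 0 := by omega
        rw [p.getVert_zero]
      | succ n ih =>
        intro i hi hil hiS
        rcases Nat.lt_or_ge i (n + 1) with hlt | hge
        · exact ih i (by omega) hil hiS
        obtain rfl : i = n + 1 := by omega
        have hadj := p.adj_getVert_succ (show n < p.length by omega)
        by_cases hnS : p.getVert n ∈ S
        · cases n with
          | zero => exact absurd (p.getVert_zero ▸ hnS) hxS
          | succ k =>
            have hc := hcol k (by omega) hnS
            have hkS : p.getVert k ∉ S := by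
              cases k with
              | zero => rwa [p.getVert_zero]
              | succ l =>
                intro hS
                exact D.asymm hc.1 (hcol l (by omega) hS).2
            refine (ih k (by omega) (by omega) hkS).trans ?_
            by_cases he : p.getVert k = p.getVert (k + 2)
            · rw [← he]
            · exact SimpleGraph.Adj.reachable ⟨hD.parents _ _ _ hc.1 hc.2 he, hkS, hiS⟩
        · exact (ih n le_rfl (by omega) hnS).trans
            (SimpleGraph.Adj.reachable ⟨hadj, hnS, hiS⟩)
    have := key p.length p.length le_rfl le_rfl (by rwa [p.getVert_length])
    rwa [p.getVert_length] at this

theorem markovEquivalent_of_moral {K : SimpleGraph V} {D D' : DAG V} (hD : Moral K D.Adj)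
    (hD' : Moral K D'.Adj) : MarkovEquivalent D D' := by
  have h1 : D.skeleton = K := by ext a b; rw [skeleton_adj, hD.adj_iff]
  have h2 : D'.skeleton = K := by ext a b; rw [skeleton_adj, hD'.adj_iff]
  intro A B S _ hAS hBS
  rw [D.dSep_iff_of_moral (by rwa [h1]) hAS hBS, D'.dSep_iff_of_moral (by rwa [h2]) hAS hBS, h1, h2]

end DAG

/-- The neighbours of `s` in `W` form a clique. -/
def Simplicial {V : Type*} (K : SimpleGraph V) (W : Finset V) (s : V) : Prop :=
  ∀ a ∈ W, ∀ b ∈ W, K.Adj s a → K.Adj s b → a ≠ b → K.Adj a b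

section Elimination

variable {V : Type*} {K : SimpleGraph V}

theorem Moral.exists_simplicial {r : V → V → Prop} (h : Moral K r) (W : Finset V)
    (hW : W.Nonempty) : ∃ s ∈ W, Simplicial K W s := by
  obtain ⟨ρ, hρ⟩ := h.rank
  obtain ⟨s, hs, hmax⟩ := W.exists_max_image ρ hW
  refine ⟨s, hs, fun a ha b hb hsa hsb hab => ?_⟩
  have hpar : ∀ c ∈ W, K.Adj s c → r c s := fun c hc hsc =>
    ((h.adj_iff _ _).1 hsc).resolve_left fun h' => absurd (hρ _ _ h') (by have := hmax c hc; omega)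
  exact h.parents _ _ _ (hpar a ha hsa) (hpar b hb hsb) hab

/-- Dirac's lemma, relative to a hereditary supply of simplicial vertices. -/
theorem isClique_or_two_simplicial
    (hK : ∀ W : Finset V, W.Nonempty → ∃ s ∈ W, Simplicial K W s) (W : Finset V) :
    (∀ a ∈ W, ∀ b ∈ W, a ≠ b → K.Adj a b) ∨
      ∃ x ∈ W, ∃ y ∈ W, x ≠ y ∧ ¬ K.Adj x y ∧ Simplicial K W x ∧ Simplicial K W y := by
  classical
  induction W using Finset.strongInduction with
  | H W ih =>
  rcases W.eq_empty_or_nonempty with rfl | hne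
  · left; simp
  obtain ⟨s, hs, hsimp⟩ := hK W hne
  have lift : ∀ x ∈ W.erase s, ¬ K.Adj x s → Simplicial K (W.erase s) x → Simplicial K W x := by
    intro x _ hxs hx a ha b hb hxa hxb hab
    refine hx a (Finset.mem_erase.2 ⟨?_, ha⟩) b (Finset.mem_erase.2 ⟨?_, hb⟩) hxa hxb hab
    · rintro rfl; exact hxs hxa
    · rintro rfl; exact hxs hxb
  rcases ih _ (Finset.erase_ssubset hs) with hc | ⟨x, hx, y, hy, hxy, hadj, hsx, hsy⟩
  · by_cases hall : ∀ a ∈ W.erase s, K.Adj s a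
    · left
      intro a ha b hb hab
      by_cases has : a = s
      · subst has; exact hall b (Finset.mem_erase.2 ⟨hab.symm, hb⟩)
      by_cases hbs : b = s
      · subst hbs; exact (hall a (Finset.mem_erase.2 ⟨hab, ha⟩)).symm
      exact hc a (Finset.mem_erase.2 ⟨has, ha⟩) b (Finset.mem_erase.2 ⟨hbs, hb⟩) hab
    · right
      push Not at hall
      obtain ⟨w, hw, hsw⟩ := hall
      refine ⟨s, hs, w, Finset.mem_of_mem_erase hw, (Finset.ne_of_mem_erase hw).symm, hsw, hsimp,
        lift w hw (fun h => hsw h.symm) fun a ha b hb _ _ hab => hc a ha b hb hab⟩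
  · right
    have hxW := Finset.mem_of_mem_erase hx
    have hyW := Finset.mem_of_mem_erase hy
    by_cases hxs : K.Adj x s
    · have hys : ¬ K.Adj y s := fun hys => hadj (hsimp x hxW y hyW hxs.symm hys.symm hxy)
      exact ⟨s, hs, y, hyW, (Finset.ne_of_mem_erase hy).symm, fun h => hys h.symm, hsimp,
        lift y hy hys hsy⟩
    · exact ⟨s, hs, x, hxW, (Finset.ne_of_mem_erase hx).symm, fun h => hxs h.symm, hsimp,
        lift x hx hxs hsx⟩

theorem exists_simplicial_ne
    (hK : ∀ W : Finset V, W.Nonempty → ∃ s ∈ W, Simplicial K W s) (W : Finset V) {u w : V}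
    (hw : w ∈ W) (hwu : w ≠ u) : ∃ s ∈ W, s ≠ u ∧ Simplicial K W s := by
  rcases isClique_or_two_simplicial hK W with h | ⟨x, hx, y, hy, hxy, -, hsx, hsy⟩
  · exact ⟨w, hw, hwu, fun a ha b hb _ _ hab => h a ha b hb hab⟩
  · by_cases hxu : x = u
    · exact ⟨y, hy, fun h => hxy (hxu.trans h.symm), hsy⟩
    · exact ⟨x, hx, hxu, hsx⟩

/-- A perfect elimination ranking of `W` in which `u` comes first. -/
theorem exists_elimination_rank
    (hK : ∀ W : Finset V, W.Nonempty → ∃ s ∈ W, Simplicial K W s) (u : V) (W : Finset V)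
    (hu : u ∈ W) : ∃ ρ : V → ℕ, Set.InjOn ρ W ∧ (∀ a ∈ W, a ≠ u → ρ u < ρ a) ∧
      ∀ a ∈ W, ∀ b ∈ W, ∀ c ∈ W, K.Adj c a → K.Adj c b → a ≠ b → ρ a < ρ c → ρ b < ρ c →
        K.Adj a b := by
  classical
  induction W using Finset.strongInduction with
  | H W ih =>
  by_cases hW : ∃ w ∈ W, w ≠ u
  · obtain ⟨w, hw, hwu⟩ := hW
    obtain ⟨s, hs, hsu, hsimp⟩ := exists_simplicial_ne hK W hw hwu
    obtain ⟨ρ, hinj, hfirst, hpeo⟩ :=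
      ih _ (Finset.erase_ssubset hs) (Finset.mem_erase.2 ⟨hsu.symm, hu⟩)
    have hlt : ∀ a ∈ W, ρ a < W.sup ρ + 1 := fun a ha => Nat.lt_succ_of_le (Finset.le_sup ha)
    refine ⟨Function.update ρ s (W.sup ρ + 1), ?_, ?_, ?_⟩
    · intro a ha b hb hab
      by_cases has : a = s <;> by_cases hbs : b = s
      · rw [has, hbs]
      · subst has
        rw [Function.update_self, Function.update_of_ne hbs] at hab
        exact absurd hab (hlt b hb).ne'
      · subst hbs
        rw [Function.update_self, Function.update_of_ne has] at hab
        exact absurd hab (hlt a ha).ne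
      · rw [Function.update_of_ne has, Function.update_of_ne hbs] at hab
        exact hinj (by simpa using ⟨ha, has⟩) (by simpa using ⟨hb, hbs⟩) hab
    · intro a ha hau
      rw [Function.update_of_ne hsu.symm]
      by_cases has : a = s
      · subst has; rw [Function.update_self]; exact hlt u hu
      · rw [Function.update_of_ne has]
        exact hfirst a (Finset.mem_erase.2 ⟨has, ha⟩) hau
    · intro a ha b hb c hc hca hcb hab hac hbc
      by_cases hcs : c = s
      · subst hcs; exact hsimp a ha b hb hca hcb hab
      · have hne : ∀ d ∈ W, Function.update ρ s (W.sup ρ + 1) d <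
            Function.update ρ s (W.sup ρ + 1) c → d ≠ s ∧ ρ d < ρ c := by
          intro d _ hd
          rw [Function.update_of_ne hcs] at hd
          by_cases hds : d = s
          · subst hds
            rw [Function.update_self] at hd
            exact absurd hd (hlt c hc).asymm
          · rw [Function.update_of_ne hds] at hd
            exact ⟨hds, hd⟩
        obtain ⟨has, hac'⟩ := hne a ha hac
        obtain ⟨hbs, hbc'⟩ := hne b hb hbc
        exact hpeo a (Finset.mem_erase.2 ⟨has, ha⟩) b (Finset.mem_erase.2 ⟨hbs, hb⟩) c
          (Finset.mem_erase.2 ⟨hcs, hc⟩) hca hcb hab hac' hbc'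
  · push Not at hW
    refine ⟨fun _ => 0, ?_, fun a ha hau => absurd (hW a ha) hau, fun a _ b _ c _ _ _ _ h => ?_⟩
    · intro a ha b hb _
      rw [hW a ha, hW b hb]
    · exact absurd h (lt_irrefl _)

/-- Every vertex is the source of some moral orientation of `K`, if there is one at all. -/
theorem Moral.exists_source [Finite V] {r : V → V → Prop} (h : Moral K r) (u : V) :
    ∃ r', Moral K r' ∧ ∀ v, K.Adj u v → r' u v := by
  have := Fintype.ofFinite V
  obtain ⟨ρ, hinj, hfirst, hpeo⟩ :=
    exists_elimination_rank h.exists_simplicial u Finset.univ (Finset.mem_univ u)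
  refine ⟨fun a b => K.Adj a b ∧ ρ a < ρ b, ⟨fun a b => ⟨fun hab => ?_, ?_⟩,
    ⟨ρ, fun a b hab => hab.2⟩, fun a b c hac hbc hab => ?_⟩, fun v hv => ⟨hv, ?_⟩⟩
  · have : ρ a ≠ ρ b := fun he => hab.ne (hinj (by simp) (by simp) he)
    rcases this.lt_or_gt with hl | hl
    · exact .inl ⟨hab, hl⟩
    · exact .inr ⟨hab.symm, hl⟩
  · rintro (hab | hab)
    · exact hab.1
    · exact hab.1.symm
  · exact hpeo a (by simp) b (by simp) c (by simp) hac.1.symm hbc.1.symm hab hac.2 hbc.2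
  · exact hfirst v (by simp) hv.ne'

end Elimination

/-- The DAG of a moral orientation. -/
def Moral.toDAG {V : Type*} {K : SimpleGraph V} {r : V → V → Prop} (h : Moral K r) : DAG V where
  Adj := r
  acyclic v hv := by
    obtain ⟨ρ, hρ⟩ := h.rank
    exact lt_irrefl _ (rank_transGen hρ hv)

/-- The DAGs with undirected essential graph `K` are the moral orientations of `K`. -/
theorem essentialGraph_eq_undirected_iff {V : Type*} [Finite V] {K : SimpleGraph V} {D : DAG V} :
    D.essentialGraph = undirected K ↔ Moral K D.Adj := by
  constructor
  · intro h
    have hadj : ∀ u v, (D.skeleton.Adj u v ∧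
        ¬ ∀ D' : DAG V, DAG.MarkovEquivalent D D' → D'.Adj v u) ↔ K.Adj u v := fun u v =>
      iff_of_eq (congrArg (fun C : Digraph V => C.Adj u v) h)
    have hrev : ∀ u v, D.Adj v u → K.Adj u v := by
      intro u v hvu
      refine ((hadj v u).1 ⟨DAG.skeleton_adj.2 (.inl hvu), fun hall => ?_⟩).symm
      exact D.asymm hvu (hall D fun _ _ _ _ _ _ => Iff.rfl)
    have hskel : ∀ a b, K.Adj a b ↔ D.Adj a b ∨ D.Adj b a := fun a b =>
      ⟨fun hK => DAG.skeleton_adj.1 ((hadj a b).2 hK).1, by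
        rintro (h' | h')
        · exact (hrev _ _ h').symm
        · exact hrev _ _ h'⟩
    refine ⟨hskel, exists_rank D.acyclic, fun a b c hac hbc hab => ?_⟩
    by_contra hn
    refine ((hadj c a).2 (hrev _ _ hac)).2 fun D' hD' => ?_
    exact (hD'.isCollider hab (fun h' => hn ((hskel a b).2 (DAG.skeleton_adj.1 h')))
      ⟨hac, hbc⟩).1
  · intro h
    ext u v
    change (D.skeleton.Adj u v ∧ _) ↔ K.Adj u v
    rw [DAG.skeleton_adj, ← h.adj_iff]
    refine ⟨fun h' => h'.1, fun hK => ⟨hK, fun hall => ?_⟩⟩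
    obtain ⟨r', hr', hsrc⟩ := h.exists_source u
    exact hr'.asymm (hsrc v hK) (hall hr'.toDAG (DAG.markovEquivalent_of_moral h hr'))

/-- The number of moral orientations of `K`. -/
noncomputable def moralCount {V : Type*} (K : SimpleGraph V) : ℕ :=
  Nat.card {r : V → V → Prop // Moral K r}

theorem Size_eq_moralCount {V : Type*} [Finite V] (K : SimpleGraph V) :
    Size K = moralCount K :=
  Nat.card_congr
    { toFun := fun D => ⟨D.1.Adj, essentialGraph_eq_undirected_iff.1 D.2⟩
      invFun := fun r => ⟨r.2.toDAG, essentialGraph_eq_undirected_iff.2 r.2⟩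
      left_inv := fun _ => rfl
      right_inv := fun _ => rfl }

section Counting

theorem Moral.comap {V V₀ : Type*} {K : SimpleGraph V} {K₀ : SimpleGraph V₀}
    {r : V → V → Prop} (h : Moral K r) (e : K₀ ↪g K) : Moral K₀ fun a b => r (e a) (e b) := by
  obtain ⟨ρ, hρ⟩ := h.rank
  refine ⟨fun a b => by rw [← h.adj_iff, e.map_adj_iff], ⟨fun a => ρ (e a), fun a b => hρ _ _⟩,
    fun a b c hac hbc hab => ?_⟩
  rw [← e.map_adj_iff]
  exact h.parents _ _ _ hac hbc (e.injective.ne hab)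

theorem moralCount_congr {V V' : Type*} {K : SimpleGraph V} {K' : SimpleGraph V'} (e : K ≃g K') :
    moralCount K = moralCount K' :=
  Nat.card_congr
    { toFun := fun r => ⟨_, r.2.comap e.symm.toEmbedding⟩
      invFun := fun r => ⟨_, r.2.comap e.toEmbedding⟩
      left_inv := fun r => by ext; simp
      right_inv := fun r => by ext; simp }

theorem Moral.of_isEmpty {V : Type*} [IsEmpty V] (K : SimpleGraph V) (r : V → V → Prop) :
    Moral K r :=
  ⟨fun a => isEmptyElim a, ⟨isEmptyElim, fun a => isEmptyElim a⟩, fun a => isEmptyElim a⟩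

theorem moralCount_of_isEmpty {V : Type*} [IsEmpty V] (K : SimpleGraph V) : moralCount K = 1 := by
  rw [moralCount, Nat.card_eq_one_iff_unique]
  exact ⟨⟨fun a b => Subtype.ext (Subsingleton.elim _ _)⟩, ⟨⟨fun _ _ => True, .of_isEmpty _ _⟩⟩⟩

/-- The acyclic orientations of a complete graph are the linear orders of its vertices. -/
theorem moralCount_top (n : ℕ) : moralCount (⊤ : SimpleGraph (Fin n)) = n.factorial := by
  have hmoral : ∀ σ : Equiv.Perm (Fin n), Moral (⊤ : SimpleGraph (Fin n)) fun a b => σ a < σ b :=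
    fun σ => ⟨fun a b => by
      rw [SimpleGraph.top_adj, ← σ.injective.ne_iff, lt_or_lt_iff_ne],
      ⟨fun a => σ a, fun a b h => h⟩, fun a b c _ _ h => h⟩
  let F : Equiv.Perm (Fin n) → {r : Fin n → Fin n → Prop // Moral ⊤ r} := fun σ => ⟨_, hmoral σ⟩
  have hF : F.Bijective := by
    constructor
    · intro σ τ h
      have hlt : ∀ a b, σ a < σ b ↔ τ a < τ b := fun a b =>
        iff_of_eq (congrFun (congrFun (congrArg Subtype.val h) a) b)
      have hm : StrictMono (σ.symm.trans τ) := fun a b hab => by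
        simpa [← hlt] using hab
      have hid : (hm.orderIsoOfSurjective _ (σ.symm.trans τ).surjective) = OrderIso.refl _ :=
        Subsingleton.elim _ _
      ext a
      have := congrArg (fun o : Fin n ≃o Fin n => o (σ a)) hid
      simpa using congrArg Fin.val this.symm
    · rintro ⟨r, hr⟩
      obtain ⟨ρ, hρ⟩ := hr.rank
      have hiff : ∀ a b, r a b ↔ ρ a < ρ b := fun a b => by
        refine ⟨hρ a b, fun hab => ?_⟩
        have hne : a ≠ b := by rintro rfl; exact lt_irrefl _ hab
        exact ((hr.adj_iff a b).1 hne).resolve_right fun h => (hρ _ _ h).asymm hab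
      have hinj : ρ.Injective := fun a b hab => by
        by_contra hne
        rcases (hr.adj_iff a b).1 hne with h | h
        · exact (hρ _ _ h).ne hab
        · exact (hρ _ _ h).ne' hab
      have hsm : StrictMono (ρ ∘ Tuple.sort ρ) :=
        (Tuple.monotone_sort ρ).strictMono_of_injective (hinj.comp (Tuple.sort ρ).injective)
      refine ⟨(Tuple.sort ρ).symm, Subtype.ext ?_⟩
      ext a b
      change (Tuple.sort ρ).symm a < (Tuple.sort ρ).symm b ↔ r a b
      rw [hiff, ← hsm.lt_iff_lt]
      simp
  rw [moralCount, ← Nat.card_eq_of_bijective F hF, Nat.card_perm, Nat.card_fin]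

theorem moralCount_top_of_equiv {V : Type*} {n : ℕ} {K : SimpleGraph V} (e : V ≃ Fin n)
    (hK : ∀ a b, a ≠ b → K.Adj a b) : moralCount K = n.factorial := by
  rw [← moralCount_top]
  exact moralCount_congr ⟨e, fun {a b} => by
    rw [SimpleGraph.top_adj, e.injective.ne_iff]; exact ⟨hK a b, SimpleGraph.Adj.ne⟩⟩

end Counting

section Extend

variable {V V' : Type*} {K : SimpleGraph V} {K' : SimpleGraph V'} {m : ℕ}

@[simp] theorem extend_adj_inl_inl {u v : V} :
    (extend K m).Adj (.inl u) (.inl v) ↔ K.Adj u v := Iff.rfl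

@[simp] theorem extend_adj_inl_inr {u : V} {i : Fin m} :
    (extend K m).Adj (.inl u) (.inr i) := Sum.inl_ne_inr

@[simp] theorem extend_adj_inr_inl {u : V} {i : Fin m} :
    (extend K m).Adj (.inr i) (.inl u) := Sum.inr_ne_inl

@[simp] theorem extend_adj_inr_inr {i i' : Fin m} :
    (extend K m).Adj (.inr i) (.inr i') ↔ i ≠ i' := Sum.inr_injective.ne_iff

/-- Embeddings of graphs extend to the extended graphs. -/
def extendEmbedding (e : K ↪g K') (m : ℕ) : extend K m ↪g extend K' m where
  toFun := Sum.map e id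
  inj' := e.injective.sumMap Function.injective_id
  map_rel_iff' := by rintro (u | i) (v | i') <;> simp

/-- Isomorphisms of graphs extend to the extended graphs. -/
def extendIso (e : K ≃g K') (m : ℕ) : extend K m ≃g extend K' m where
  toEquiv := Equiv.sumCongr e.toEquiv (Equiv.refl _)
  map_rel_iff' := by
    rintro (u | i) (v | i') <;> simp [SimpleGraph.Iso.map_adj_iff]

end Extend

/-- `K` together with one isolated vertex. -/
abbrev addPoint {V : Type*} (K : SimpleGraph V) : SimpleGraph (V ⊕ Unit) :=
  K.sum (⊥ : SimpleGraph Unit)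

section Step

variable {V : Type*} {K : SimpleGraph V} {m : ℕ}

/-- In `r`, the isolated vertex added to `K` comes after all dominating vertices. -/
def PointLast (r : (V ⊕ Unit) ⊕ Fin m → (V ⊕ Unit) ⊕ Fin m → Prop) : Prop :=
  ∀ i, r (.inr i) (.inl (.inr ()))

/-- Extend an orientation of `K^{m+}` by an isolated vertex of `K`, as a sink. -/
def addSink (r : V ⊕ Fin m → V ⊕ Fin m → Prop) :
    (V ⊕ Unit) ⊕ Fin m → (V ⊕ Unit) ⊕ Fin m → Prop
  | .inl (.inl a), .inl (.inl b) => r (.inl a) (.inl b)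
  | .inl (.inl a), .inr i => r (.inl a) (.inr i)
  | .inr i, .inl (.inl a) => r (.inr i) (.inl a)
  | .inr i, .inr i' => r (.inr i) (.inr i')
  | .inr _, .inl (.inr _) => True
  | .inl (.inr _), _ => False
  | .inl (.inl _), .inl (.inr _) => False

theorem Moral.addSink [Finite V] {r : V ⊕ Fin m → V ⊕ Fin m → Prop} (h : Moral (extend K m) r) :
    Moral (extend (addPoint K) m) (addSink r) := by
  obtain ⟨ρ, hρ⟩ := h.rank
  obtain ⟨N, hN⟩ := (Set.finite_range ρ).bddAbove
  have hN' : ∀ x, ρ x < N + 1 := fun x => Nat.lt_succ_of_le (hN ⟨x, rfl⟩)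
  refine ⟨?_, ⟨Sum.elim (Sum.elim (fun a => ρ (.inl a)) fun _ => N + 1) fun i => ρ (.inr i), ?_⟩,
    ?_⟩
  · rintro ((a | _) | i) ((b | _) | i') <;> simp [MarkovSize.addSink, ← h.adj_iff]
  · rintro ((a | _) | i) ((b | _) | i') <;> simp [MarkovSize.addSink, hN'] <;> exact hρ _ _
  · have hpar : ∀ x y z, r x z → r y z → x ≠ y → (extend K m).Adj x y := h.parents
    rintro ((a | _) | i) ((b | _) | i') ((c | _) | k) <;>
      simp only [MarkovSize.addSink, false_imp_iff, imp_true_iff, extend_adj_inl_inr,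
        extend_adj_inr_inl, extend_adj_inr_inr, ne_eq, Sum.inr.injEq, imp_self]
    all_goals
      intro h1 h2 h3
      simpa using hpar _ _ _ h1 h2 (by simpa using h3)

theorem Moral.not_adj_right {r : V → V → Prop} (h : Moral K r) {a b : V} (hab : ¬ K.Adj a b) :
    ¬ r a b := fun h' => hab ((h.adj_iff a b).2 (.inl h'))

/-- Deleting the isolated vertex is a bijection if that vertex comes last. -/
theorem card_pointLast [Finite V] (K : SimpleGraph V) (m : ℕ) :
    Nat.card {r // Moral (extend (addPoint K) m) r ∧ PointLast r} = moralCount (extend K m) :=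
  Nat.card_congr
    { toFun := fun r => ⟨_, r.2.1.comap (extendEmbedding SimpleGraph.Embedding.sumInl m)⟩
      invFun := fun r => ⟨addSink r.1, r.2.addSink, fun _ => trivial⟩
      left_inv := by
        rintro ⟨r, hr, hlast⟩
        refine Subtype.ext ?_
        ext x y
        rcases x with (a | _) | i <;> rcases y with (b | _) | i'
        case inl.inl.inl.inr => simpa [addSink] using hr.not_adj_right (by simp)
        case inl.inr.inl.inl => simpa [addSink] using hr.not_adj_right (by simp)
        case inl.inr.inl.inr => simpa [addSink] using hr.not_adj_right (by simp)
        case inl.inr.inr => simpa [addSink] using hr.asymm (hlast i')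
        case inr.inl.inr => simpa [addSink] using hlast i
        all_goals exact Iff.rfl
      right_inv := by
        rintro ⟨r, hr⟩
        refine Subtype.ext ?_
        ext x y
        rcases x with a | i <;> rcases y with b | i' <;> exact Iff.rfl }

/-- If the isolated vertex does not come last, the dominating vertices precede all of `K`. -/
theorem Moral.dominating_of_not_pointLast {r : (V ⊕ Unit) ⊕ Fin m → (V ⊕ Unit) ⊕ Fin m → Prop}
    (h : Moral (extend (addPoint K) m) r) (hp : ¬ PointLast r) (i : Fin m) (a : V) :
    r (.inr i) (.inl (.inl a)) := by
  obtain ⟨d, hd⟩ := not_forall.1 hp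
  have hpd : r (.inl (.inr ())) (.inr d) :=
    ((h.adj_iff _ _).1 extend_adj_inl_inr).resolve_right hd
  -- a child of the isolated vertex has no parents in `K`
  have hK : ∀ i, r (.inl (.inr ())) (.inr i) → r (.inr i) (.inl (.inl a)) := fun i hi =>
    ((h.adj_iff _ _).1 extend_adj_inr_inl).resolve_right fun hai => by
      simpa using h.parents _ _ _ hai hi (by simp)
  by_contra hn
  have hai : r (.inl (.inl a)) (.inr i) :=
    ((h.adj_iff _ _).1 extend_adj_inl_inr).resolve_right hn
  obtain ⟨ρ, hρ⟩ := h.rank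
  rcases (h.adj_iff (.inl (.inr ())) (.inr i)).1 extend_adj_inl_inr with hpi | hip
  · exact hn (hK i hpi)
  · have h1 := hρ _ _ hai
    have h2 := hρ _ _ hip
    have h3 := hρ _ _ hpd
    have h4 := hρ _ _ (hK d hpd)
    omega

/-- Orient `K` by `r`, the dominating vertices and the isolated vertex by `t`, and put the former
vertices after the dominating ones. -/
def joinBelow (r : V → V → Prop) (t : (Empty ⊕ Unit) ⊕ Fin m → (Empty ⊕ Unit) ⊕ Fin m → Prop) :
    (V ⊕ Unit) ⊕ Fin m → (V ⊕ Unit) ⊕ Fin m → Prop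
  | .inl (.inl a), .inl (.inl b) => r a b
  | .inl (.inl _), .inl (.inr _) => False
  | .inl (.inl _), .inr _ => False
  | .inl (.inr _), .inl (.inl _) => False
  | .inl (.inr u), .inl (.inr u') => t (.inl (.inr u)) (.inl (.inr u'))
  | .inl (.inr u), .inr i => t (.inl (.inr u)) (.inr i)
  | .inr _, .inl (.inl _) => True
  | .inr i, .inl (.inr u) => t (.inr i) (.inl (.inr u))
  | .inr i, .inr i' => t (.inr i) (.inr i')

theorem Moral.joinBelow {r : V → V → Prop}
    {t : (Empty ⊕ Unit) ⊕ Fin m → (Empty ⊕ Unit) ⊕ Fin m → Prop} (h : Moral K r)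
    (ht : Moral (extend (addPoint (⊥ : SimpleGraph Empty)) m) t) :
    Moral (extend (addPoint K) m) (joinBelow r t) := by
  obtain ⟨ρ, hρ⟩ := h.rank
  obtain ⟨τ, hτ⟩ := ht.rank
  obtain ⟨N, hN⟩ := (Set.finite_range τ).bddAbove
  have hN' : ∀ x a, τ x < ρ a + (N + 1) := fun x a => by
    have := hN ⟨x, rfl⟩
    omega
  refine ⟨?_, ⟨Sum.elim (Sum.elim (fun a => ρ a + (N + 1)) fun u => τ (.inl (.inr u)))
    fun i => τ (.inr i), ?_⟩, ?_⟩
  · rintro ((a | _) | i) ((b | _) | i') <;> simp [MarkovSize.joinBelow, ← h.adj_iff, ← ht.adj_iff]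
    simpa using ht.not_adj_right (a := .inl (.inr ())) (b := .inl (.inr ())) (by simp)
  · rintro ((a | _) | i) ((b | _) | i') <;>
      simp only [MarkovSize.joinBelow, false_imp_iff, true_imp_iff, Sum.elim_inl, Sum.elim_inr,
        hN'] <;>
      first
        | exact hτ _ _
        | exact fun h' => by have := hρ _ _ h'; omega
  · rintro ((a | _) | i) ((b | _) | i') ((c | _) | k) <;>
      simp only [MarkovSize.joinBelow, false_imp_iff, imp_true_iff,
        extend_adj_inl_inr, extend_adj_inr_inl, extend_adj_inr_inr, ne_eq, Sum.inr.injEq, imp_self,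
        not_true_eq_false]
    intro h1 h2 h3
    simpa using h.parents _ _ _ h1 h2 (by simpa using h3)

theorem card_not_pointLast (K : SimpleGraph V) (m : ℕ) :
    Nat.card {r // Moral (extend (addPoint K) m) r ∧ ¬ PointLast r} = moralCount K *
      Nat.card {t // Moral (extend (addPoint (⊥ : SimpleGraph Empty)) m) t ∧ ¬ PointLast t} := by
  let ι : addPoint (⊥ : SimpleGraph Empty) ↪g addPoint K :=
    { toFun := Sum.map Empty.elim id
      inj' := (Function.injective_of_subsingleton _).sumMap Function.injective_id
      map_rel_iff' := by rintro (⟨⟨⟩⟩ | _) (⟨⟨⟩⟩ | _); simp }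
  let κ : K ↪g extend (addPoint K) m :=
    { toFun := fun a => .inl (.inl a)
      inj' := Sum.inl_injective.comp Sum.inl_injective
      map_rel_iff' := by simp }
  rw [moralCount, ← Nat.card_prod]
  exact Nat.card_congr
    { toFun := fun r => ⟨⟨_, r.2.1.comap κ⟩,
        ⟨_, r.2.1.comap (extendEmbedding ι m), fun hl => r.2.2 hl⟩⟩
      invFun := fun p => ⟨joinBelow p.1.1 p.2.1, p.1.2.joinBelow p.2.2.1, fun hl => p.2.2.2 hl⟩
      left_inv := by
        rintro ⟨r, hr, hlast⟩
        have hdom := hr.dominating_of_not_pointLast hlast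
        refine Subtype.ext ?_
        ext x y
        rcases x with (a | _) | i <;> rcases y with (b | _) | i'
        case inl.inl.inl.inr => simpa [joinBelow] using hr.not_adj_right (by simp)
        case inl.inr.inl.inl => simpa [joinBelow] using hr.not_adj_right (by simp)
        case inl.inl.inr => simpa [joinBelow] using hr.asymm (hdom _ _)
        case inr.inl.inl => simpa [joinBelow] using hdom _ _
        all_goals exact Iff.rfl
      right_inv := by
        rintro ⟨⟨r, hr⟩, ⟨t, ht, hlast⟩⟩
        refine Prod.ext (Subtype.ext rfl) (Subtype.ext ?_)
        ext x y
        rcases x with (⟨⟨⟩⟩ | _) | i <;> rcases y with (⟨⟨⟩⟩ | _) | i' <;> exact Iff.rfl }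

theorem card_subtype_and_add_card_subtype_and_not {α : Type*} [Finite α] (p q : α → Prop) :
    Nat.card {x // p x ∧ q x} + Nat.card {x // p x ∧ ¬ q x} = Nat.card {x // p x} := by
  classical
  rw [← Nat.card_congr (Equiv.sumCompl fun x : {x // p x} => q x), Nat.card_sum,
    Nat.card_congr (Equiv.subtypeSubtypeEquivSubtypeInter p q),
    Nat.card_congr (Equiv.subtypeSubtypeEquivSubtypeInter p fun x => ¬ q x)]

theorem moralCount_extend_addPoint_eq_add [Finite V] (K : SimpleGraph V) (m : ℕ) :
    moralCount (extend (addPoint K) m) = moralCount (extend K m) + moralCount K *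
      Nat.card {t // Moral (extend (addPoint (⊥ : SimpleGraph Empty)) m) t ∧ ¬ PointLast t} := by
  rw [← card_not_pointLast, ← card_pointLast K, card_subtype_and_add_card_subtype_and_not]
  rfl

theorem moralCount_extend_of_isEmpty [IsEmpty V] (K : SimpleGraph V) (m : ℕ) :
    moralCount (extend K m) = m.factorial :=
  moralCount_top_of_equiv (Equiv.emptySum V (Fin m)) (by
    rintro (a | i) (b | i') h
    · exact isEmptyElim a
    · simp
    · simp
    · simpa using h)

theorem card_empty_not_pointLast (m : ℕ) :
    Nat.card {t // Moral (extend (addPoint (⊥ : SimpleGraph Empty)) m) t ∧ ¬ PointLast t} =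
      m * m.factorial := by
  have h := moralCount_extend_addPoint_eq_add (⊥ : SimpleGraph Empty) m
  have htop : moralCount (extend (addPoint (⊥ : SimpleGraph Empty)) m) = (m + 1).factorial :=
    moralCount_top_of_equiv
      ((Equiv.sumComm _ _).trans ((Equiv.sumCongr (Equiv.refl _)
        ((Equiv.emptySum Empty Unit).trans finOneEquiv.symm)).trans finSumFinEquiv)) (by
      rintro ((⟨⟨⟩⟩ | _) | i) ((⟨⟨⟩⟩ | _) | i') h <;> simp_all)
  rw [htop, moralCount_extend_of_isEmpty, moralCount_of_isEmpty, Nat.factorial_succ] at h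
  linarith

/-- Adding one isolated vertex. -/
theorem moralCount_extend_addPoint [Finite V] (K : SimpleGraph V) (m : ℕ) :
    moralCount (extend (addPoint K) m) =
      moralCount (extend K m) + moralCount K * (m * m.factorial) := by
  rw [moralCount_extend_addPoint_eq_add, card_empty_not_pointLast]

end Step

section Points

variable {V : Type*} (K : SimpleGraph V)

/-- Adding no isolated vertices changes nothing. -/
def sumBotZeroIso : K.sum (⊥ : SimpleGraph (Fin 0)) ≃g K where
  toEquiv := Equiv.sumEmpty V (Fin 0)
  map_rel_iff' := by
    rintro (a | i) (b | i')
    · simp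
    all_goals first | exact i.elim0 | exact i'.elim0

/-- Isolated vertices can be added one by one. -/
def sumBotSuccIso (j : ℕ) :
    K.sum (⊥ : SimpleGraph (Fin (j + 1))) ≃g addPoint (K.sum (⊥ : SimpleGraph (Fin j))) where
  toEquiv := (Equiv.sumCongr (Equiv.refl V)
    (finSumFinEquiv.symm.trans (Equiv.sumCongr (Equiv.refl _) finOneEquiv))).trans
      (Equiv.sumAssoc V (Fin j) Unit).symm
  map_rel_iff' := by
    have hinr : ∀ i : Fin (j + 1), ∃ x : Fin j ⊕ Unit,
        ((Equiv.sumCongr (Equiv.refl V)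
          (finSumFinEquiv.symm.trans (Equiv.sumCongr (Equiv.refl _) finOneEquiv))).trans
          (Equiv.sumAssoc V (Fin j) Unit).symm) (.inr i) =
          (Equiv.sumAssoc V (Fin j) Unit).symm (.inr x) := fun i => ⟨_, rfl⟩
    rintro (a | i) (b | i')
    · simp
    · obtain ⟨x | x, hx⟩ := hinr i' <;> rw [hx] <;> simp
    · obtain ⟨x | x, hx⟩ := hinr i <;> rw [hx] <;> simp
    · obtain ⟨x | x, hx⟩ := hinr i <;> obtain ⟨y | y, hy⟩ := hinr i' <;> rw [hx, hy] <;> simp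

theorem moralCount_extend_sum_bot [Finite V] (m j : ℕ) :
    moralCount (extend (K.sum (⊥ : SimpleGraph (Fin j))) m) =
      moralCount (extend K m) + j * moralCount K * (m * m.factorial) := by
  have hcount : ∀ j, moralCount (K.sum (⊥ : SimpleGraph (Fin j))) = moralCount K := by
    intro j
    induction j with
    | zero => exact moralCount_congr (sumBotZeroIso K)
    | succ j ih =>
      have hext : ∀ {W : Type _} (G : SimpleGraph W), moralCount (extend G 0) = moralCount G :=
        fun {W} G => moralCount_congr
          ⟨Equiv.sumEmpty W (Fin 0), by
            rintro (a | i) (b | i')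
            · simp
            all_goals first | exact i.elim0 | exact i'.elim0⟩
      rw [moralCount_congr (sumBotSuccIso K j), ← hext, moralCount_extend_addPoint, hext, ih]
      simp
  induction j with
  | zero => simpa using moralCount_congr (extendIso (sumBotZeroIso K) m)
  | succ j ih =>
    rw [moralCount_congr (extendIso (sumBotSuccIso K j) m), moralCount_extend_addPoint, ih, hcount]
    ring

end Points

end MarkovSize

/-- Chordality of `K₁` is not needed: if `K₁` is not chordal, then all the sizes are zero. -/
theorem corollary2 {V V₁ : Type*} [Finite V] [Finite V₁] (K : SimpleGraph V)
    (K₁ : SimpleGraph V₁) (j m : ℕ) (hK₁ : MarkovSize.IsChordal K₁)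
    (hK : MarkovSize.IsComposedOf K K₁ j) :
    MarkovSize.f K m =
        MarkovSize.f K₁ m + j * MarkovSize.Size K₁ * (m * Nat.factorial m) ∧
      (IsEmpty V₁ → MarkovSize.f K m = (j * m + 1) * Nat.factorial m) := by
  obtain ⟨e⟩ := hK
  have main : MarkovSize.f K m =
      MarkovSize.f K₁ m + j * MarkovSize.Size K₁ * (m * Nat.factorial m) := by
    rw [MarkovSize.f, MarkovSize.f, MarkovSize.Size_eq_moralCount, MarkovSize.Size_eq_moralCount,
      MarkovSize.Size_eq_moralCount, MarkovSize.moralCount_congr (MarkovSize.extendIso e m),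
      MarkovSize.moralCount_extend_sum_bot]
  refine ⟨main, fun hV => ?_⟩
  rw [main, MarkovSize.f, MarkovSize.Size_eq_moralCount, MarkovSize.Size_eq_moralCount,
    MarkovSize.moralCount_extend_of_isEmpty, MarkovSize.moralCount_of_isEmpty]
  ring
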